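/- For a rational number $\alpha$ let $r_\alpha$ be its denominator (the least positive integer $r$ with $r\alpha\in\mathbb Z$) and put $\Delta_\alpha=\frac12\left(1-\frac1{r_\alpha^2}\right)$. For rational numbers $\alpha,\beta$ with $3+\alpha-\beta\neq 0$ put $$\alpha.\beta=\frac{\alpha+\beta}{2}+\frac{\Delta_\beta-\Delta_\alpha}{3+\alpha-\beta}.$$ Let $\varepsilon:\mathbb Z[\tfrac12]\to\mathbb Q$ be the map defined inductively by $\varepsilon(n)=n$ for $n\in\mathbb Z$ and $$\varepsilon\left(\frac{2p+1}{2^q}\right)=\varepsilon\left(\frac{p}{2^{q-1}}\right).\,\varepsilon\left(\frac{p+1}{2^{q-1}}\right)\qquad(p\in\mathbb Z,\ q\ge 1),$$ and let $\mathcal E=\varepsilon(\mathbb Z[\tfrac12])$ be the set of exceptional slopes (by Drezet and Le Potier, these are the slopes of the exceptional bundles on $\mathbb P^2$). For $\alpha\in\mathcal E$ let $$x_\alpha=\frac32-\sqrt{\frac94-\frac1{r_\alpha^2}},\qquad I_\alpha=(\alpha-x_\alpha,\ \alpha+x_\alpha)\subset\mathbb R,$$ and let $C=\mathbb R\setminus\bigcup_{\alpha\in\mathcal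 E}I_\alpha$ be the generalized Cantor set. Let $D>5$ be a rational number. Then the number $$\xi=\frac{-3+\sqrt D}{2}$$ lies in $I_\alpha$ for some $\alpha\in\mathcal E$. That is, $\xi$ is not in $C$. -/

import Mathlib

namespace ExceptionalSlope

/-- The discriminant `Δ_α = (1 - 1 / r_α ^ 2) / 2`, where `r_α = α.den` is the least positive
integer `r` with `r α ∈ ℤ`. -/
def disc (α : ℚ) : ℚ := 1 / 2 * (1 - 1 / (α.den : ℚ) ^ 2)

/-- The operation `α.β = (α + β) / 2 + (Δ_β - Δ_α) / (3 + α - β)`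
(meaningful when `3 + α - β ≠ 0`). -/
def dot (α β : ℚ) : ℚ := (α + β) / 2 + (disc β - disc α) / (3 + α - β)

/-- `eps q p` is the value `ε (p / 2 ^ q)` of the map `ε` on dyadic rationals. In the last clause,
`p / 2` is the floor of `p / 2`, so that an odd `p` equals `2 * (p / 2) + 1`.
The three lemmas below are the defining recursion, and `eps_congr` says that the value depends only
on the dyadic number `p / 2 ^ q`. -/
def eps : ℕ → ℤ → ℚ
  | 0, p => p
  | q + 1, p => if p % 2 = 0 then eps q (p / 2) else dot (eps q (p / 2)) (eps q (p / 2 + 1))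

theorem eps_zero (n : ℤ) : eps 0 n = n := rfl

theorem eps_succ_even (q : ℕ) (p : ℤ) : eps (q + 1) (2 * p) = eps q p := by
  have h : 2 * p / 2 = p := by omega
  simp [eps, h]

theorem eps_succ_odd (q : ℕ) (p : ℤ) :
    eps (q + 1) (2 * p + 1) = dot (eps q p) (eps q (p + 1)) := by
  have h : (2 * p + 1) / 2 = p := by omega
  have h' : (2 * p + 1) % 2 ≠ 0 := by omega
  rw [eps, if_neg h', h]

theorem eps_add (q k : ℕ) (p : ℤ) : eps (q + k) (2 ^ k * p) = eps q p := by
  induction k with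
  | zero => simp
  | succ k ih =>
    have h : (2 : ℤ) ^ (k + 1) * p = 2 * (2 ^ k * p) := by ring
    rw [h, ← add_assoc, eps_succ_even, ih]

/-- `ε` is well defined on dyadic rationals. -/
theorem eps_congr {q q' : ℕ} {p p' : ℤ} (h : (p : ℚ) / 2 ^ q = (p' : ℚ) / 2 ^ q') :
    eps q p = eps q' p' := by
  wlog hq : q ≤ q' generalizing q q' p p'
  · exact (this h.symm (le_of_not_ge hq)).symm
  obtain ⟨k, rfl⟩ := Nat.exists_eq_add_of_le hq
  have h1 : (p' : ℚ) = 2 ^ k * p := by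
    rw [div_eq_div_iff (by positivity) (by positivity), pow_add] at h
    have h2 : (2 : ℚ) ^ q ≠ 0 := by positivity
    apply mul_right_cancel₀ h2
    linarith
  have h3 : p' = 2 ^ k * p := by exact_mod_cast h1
  rw [h3, eps_add]

/-- The set of exceptional slopes: all values `ε (p / 2 ^ q)`. -/
def slopes : Set ℚ := {α | ∃ (q : ℕ) (p : ℤ), eps q p = α}

/-- `x_α = 3 / 2 - √(9 / 4 - 1 / r_α ^ 2)`. -/
noncomputable def radius (α : ℚ) : ℝ := 3 / 2 - Real.sqrt (9 / 4 - 1 / (α.den : ℝ) ^ 2)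

/-- The open interval `I_α = (α - x_α, α + x_α)`. -/
noncomputable def interval (α : ℚ) : Set ℝ := Set.Ioo ((α : ℝ) - radius α) ((α : ℝ) + radius α)

/-- The generalized Cantor set: the complement in `ℝ` of the union of the `I_α` over all
exceptional slopes `α`. -/
noncomputable def cantorSet : Set ℝ := (⋃ α ∈ slopes, interval α)ᶜ

end ExceptionalSlope

/-! Suppose ξ avoids every I_α. Bisecting by α.β traps ξ in nested adjacent pairs (α_n, β_n), and
each time in the core [α + x_α, β - x_β]. Two increasing Möbius maps L_α and R_β act on the core;
their fixed points there are its endpoints, and L_α(β) = α.β = R_β(α). The key identities are L_α ∘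
R_β = R_{α.β} and R_β ∘ L_α = L_{α.β}: the maps of a child pair are words in those of its parent.
Hence ξ can be pulled back indefinitely along the maps of every pair in the chain.

For the integral pair (m, m + 1) both maps have integral matrices of determinant one. Pulling back a
root of an integral quadratic form therefore keeps the discriminant, and also a bound on the leading
coefficient, so only finitely many points arise (`quadraticPoints_closed`,
`finite_quadraticPoints`).

The points of this finite set that can be pulled back forever at level n decrease with n, so two
consecutive levels agree. There all pullbacks use the same map, and monotonicity forces each point
to be fixed (`IsChain.exists_fixed`). So ξ would be a fixed point of some L_α or R_β; as x_α is
irrational, this happens only for D = 5. -/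

namespace ExceptionalSlope

/-! ### Adjacent slopes and the Markov equation -/

/-- Adjacent exceptional slopes: `α < β ≤ α + 1`, both numerators are square roots of `-1` modulo
the denominators, and the Markov-type equation holds. -/
structure Adj (α β : ℚ) : Prop where
  left_dvd : (α.den : ℤ) ∣ α.num ^ 2 + 1
  right_dvd : (β.den : ℤ) ∣ β.num ^ 2 + 1
  lt : α < β
  le : β ≤ α + 1
  eq : (β - α) ^ 2 - 3 * (β - α) + 1 / (α.den : ℚ) ^ 2 + 1 / (β.den : ℚ) ^ 2 = 0

theorem num_den_of_eq {δ : ℚ} {P R S : ℤ} (hR : 0 < R) (h : P ^ 2 + 1 = R * S)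
    (hδ : δ = P / R) : δ.num = P ∧ (δ.den : ℤ) = R := by
  have hc : IsCoprime P R := ⟨-P, S, by linear_combination -h⟩
  have hc' : Nat.Coprime P.natAbs R.natAbs := Int.isCoprime_iff_gcd_eq_one.mp hc
  subst hδ
  exact ⟨Rat.num_div_eq_of_coprime hR hc', Rat.den_div_eq_of_coprime hR hc'⟩

/-- The Markov-type equation eliminates `β.den` from the discriminant quotient; this form says that
α.β is the image of β under a Möbius map depending only on α. -/
theorem Adj.dot_eq_left {α β : ℚ} (h : Adj α β) :
    dot α β = α + 1 / ((α.den : ℚ) ^ 2 * (3 - (β - α))) := by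
  have h1 := h.le
  have h2 : (3 - (β - α)) ≠ 0 := by linarith
  have h3 : (3 + α - β) ≠ 0 := by linarith
  have h4 : (α.den : ℚ) ≠ 0 := by exact_mod_cast α.den_nz
  have e := h.eq
  unfold dot disc
  have h5 : (β.den : ℚ) ≠ 0 := by exact_mod_cast β.den_nz
  set x : ℚ := 1 / (α.den : ℚ) ^ 2 with hx
  set y : ℚ := 1 / (β.den : ℚ) ^ 2 with hy
  have : 1 / ((α.den : ℚ) ^ 2 * (3 - (β - α))) = x / (3 - (β - α)) := by
    rw [hx]; field_simp
  rw [this, show 3 + α - β = 3 - (β - α) by ring]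
  have hu : (α + β) / 2 + (1 / 2 * (1 - y) - 1 / 2 * (1 - x)) / (3 - (β - α))
      - (α + x / (3 - (β - α))) = 0 := by
    field_simp
    linear_combination -e
  linear_combination hu

theorem Adj.dot_eq_right {α β : ℚ} (h : Adj α β) :
    dot α β = β - 1 / ((β.den : ℚ) ^ 2 * (3 - (β - α))) := by
  have h1 := h.le
  have h2 : (3 - (β - α)) ≠ 0 := by linarith
  have h4 : (α.den : ℚ) ≠ 0 := by exact_mod_cast α.den_nz
  have h5 : (β.den : ℚ) ≠ 0 := by exact_mod_cast β.den_nz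
  rw [h.dot_eq_left, ← sub_eq_zero]
  have e := h.eq
  set x : ℚ := 1 / (α.den : ℚ) ^ 2 with hx
  set y : ℚ := 1 / (β.den : ℚ) ^ 2 with hy
  have e1 : 1 / ((α.den : ℚ) ^ 2 * (3 - (β - α))) = x / (3 - (β - α)) := by
    rw [hx]; field_simp
  have e2 : 1 / ((β.den : ℚ) ^ 2 * (3 - (β - α))) = y / (3 - (β - α)) := by
    rw [hy]; field_simp
  rw [e1, e2]
  field_simp
  linear_combination e

theorem Adj.dot_num_den {α β : ℚ} (h : Adj α β) :
    ((dot α β).den : ℤ) ∣ (dot α β).num ^ 2 + 1 ∧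
      ((dot α β).den : ℚ) = α.den * β.den * (3 - (β - α)) := by
  obtain ⟨s, hs⟩ := h.left_dvd
  obtain ⟨s', hs'⟩ := h.right_dvd
  have h4 : (α.den : ℚ) ≠ 0 := by exact_mod_cast α.den_nz
  have h5 : (β.den : ℚ) ≠ 0 := by exact_mod_cast β.den_nz
  have ha : α = (α.num : ℚ) / (α.den : ℚ) := α.num_div_den.symm
  have hb : β = (β.num : ℚ) / (β.den : ℚ) := β.num_div_den.symm
  have hle := h.le
  have e := h.eq
  have hd := h.dot_eq_left
  have hpos : 0 < 3 - (β - α) := by linarith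
  generalize hp : α.num = p at *
  generalize hp' : β.num = p' at *
  have hrpos : (0 : ℚ) < α.den := by exact_mod_cast α.den_pos
  have hrpos' : (0 : ℚ) < β.den := by exact_mod_cast β.den_pos
  obtain ⟨r, hr⟩ : ∃ r : ℤ, (α.den : ℤ) = r := ⟨_, rfl⟩
  obtain ⟨r', hr'⟩ : ∃ r : ℤ, (β.den : ℤ) = r := ⟨_, rfl⟩
  have hrq : (α.den : ℚ) = r := by exact_mod_cast hr
  have hrq' : (β.den : ℚ) = r' := by exact_mod_cast hr'
  rw [hr] at hs
  rw [hr'] at hs'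
  rw [hrq] at h4 ha e hd hrpos ⊢
  rw [hrq'] at h5 hb e hrpos' ⊢
  have hsq : (p : ℚ) ^ 2 + 1 = r * s := by exact_mod_cast hs
  have hsq' : (p' : ℚ) ^ 2 + 1 = r' * s' := by exact_mod_cast hs'
  have hE : (s * r' + s' * r + 3 * (p * r' - p' * r) : ℚ) = 2 * p * p' := by
    rw [ha, hb] at e
    field_simp at e
    apply mul_left_cancel₀ (mul_ne_zero h4 h5)
    linear_combination e - r' ^ 2 * hsq - r ^ 2 * hsq'
  have hE' : s * r' + s' * r + 3 * (p * r' - p' * r) = 2 * p * p' := by exact_mod_cast hE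
  have hR : ((3 * r * r' - (p' * r - p * r') : ℤ) : ℚ) = r * r' * (3 - (β - α)) := by
    rw [ha, hb]; push_cast; field_simp
  have hRpos : 0 < 3 * r * r' - (p' * r - p * r') := by
    have : (0 : ℚ) < ((3 * r * r' - (p' * r - p * r') : ℤ) : ℚ) := by rw [hR]; positivity
    exact_mod_cast this
  -- P / R is p' / r' moved by the matrix (-p, s + 3p; -r, 3r + p) of L_α, whose determinant is rs -
  -- p² = 1. The same matrix sends (3p' - s', 3r' - p') to (3P - S, 3R - P), by `hE'`, so P² + 1 =
  -- RS is again a determinant identity and P / R is in lowest terms.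
  have key := num_den_of_eq (δ := dot α β) (P := -p * p' + (s + 3 * p) * r')
    (R := 3 * r * r' - (p' * r - p * r'))
    (S := 3 * (-p * p' + (s + 3 * p) * r') - (-p * (3 * p' - s') + (s + 3 * p) * (3 * r' - p')))
    hRpos (by linear_combination (-p * p' + (s + 3 * p) * r') * hE' + (r' * s' - p' ^ 2) * hs + hs')
    (by
      rw [hR, hd, eq_div_iff (by positivity)]
      have hα : α * r = p := by rw [ha]; field_simp
      have hβ : β * r' = p' := by rw [hb]; field_simp
      have hR' : (r : ℚ) * r' * (3 - (β - α)) = 3 * r * r' - (p' * r - p * r') := by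
        rw [← hR]; push_cast; ring
      have hinv : 1 / ((r : ℚ) ^ 2 * (3 - (β - α))) * (r * r' * (3 - (β - α))) * r = r' := by
        field_simp
      apply mul_right_cancel₀ h4
      push_cast
      linear_combination hinv + α * r * hR' + (3 * r * r' - (p' * r - p * r')) * hα + r' * hsq)
  refine ⟨?_, ?_⟩
  · rw [key.1, key.2]
    exact ⟨3 * (-p * p' + (s + 3 * p) * r') - (-p * (3 * p' - s') + (s + 3 * p) * (3 * r' - p')),
      by linear_combination (-p * p' + (s + 3 * p) * r') * hE' + (r' * s' - p' ^ 2) * hs + hs'⟩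
  · rw [← hR, ← key.2]; simp

theorem Adj.inv_den_sq {α β : ℚ} (h : Adj α β) : 1 / ((dot α β).den : ℚ) ^ 2 =
    1 / (α.den : ℚ) ^ 2 * (1 / (β.den : ℚ) ^ 2) / (3 - (β - α)) ^ 2 := by
  rw [h.dot_num_den.2]
  simp only [one_div, mul_pow, mul_inv]
  ring

theorem Adj.lt_dot {α β : ℚ} (h : Adj α β) : α < dot α β := by
  have h1 := h.le
  have h2 : 0 < 3 - (β - α) := by linarith
  have h3 : (0 : ℚ) < α.den := by exact_mod_cast α.den_pos
  rw [h.dot_eq_left, lt_add_iff_pos_right]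
  positivity

theorem Adj.dot_lt {α β : ℚ} (h : Adj α β) : dot α β < β := by
  have h1 := h.le
  have h2 : 0 < 3 - (β - α) := by linarith
  have h3 : (0 : ℚ) < β.den := by exact_mod_cast β.den_pos
  rw [h.dot_eq_right, sub_lt_self_iff]
  positivity

theorem Adj.left {α β : ℚ} (h : Adj α β) : Adj α (dot α β) where
  left_dvd := h.left_dvd
  right_dvd := h.dot_num_den.1
  lt := h.lt_dot
  le := h.dot_lt.le.trans h.le
  eq := by
    have h1 := h.le
    have h2 : 3 - (β - α) ≠ 0 := by linarith
    have e := h.eq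
    have hd : dot α β - α = 1 / (α.den : ℚ) ^ 2 / (3 - (β - α)) := by
      rw [h.dot_eq_left, ← div_div]; ring
    rw [h.inv_den_sq, hd]
    generalize 1 / (α.den : ℚ) ^ 2 = x at *
    generalize 1 / (β.den : ℚ) ^ 2 = y at *
    field_simp
    linear_combination x * e

theorem Adj.right {α β : ℚ} (h : Adj α β) : Adj (dot α β) β where
  left_dvd := h.dot_num_den.1
  right_dvd := h.right_dvd
  lt := h.dot_lt
  le := h.le.trans (by linarith [h.lt_dot])
  eq := by
    have h1 := h.le
    have h2 : 3 - (β - α) ≠ 0 := by linarith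
    have e := h.eq
    have hd : β - dot α β = 1 / (β.den : ℚ) ^ 2 / (3 - (β - α)) := by
      rw [h.dot_eq_right, ← div_div]; ring
    rw [h.inv_den_sq, hd]
    generalize 1 / (α.den : ℚ) ^ 2 = x at *
    generalize 1 / (β.den : ℚ) ^ 2 = y at *
    field_simp
    linear_combination y * e

theorem adj_intCast (m : ℤ) : Adj m (m + 1 : ℤ) where
  left_dvd := by simp
  right_dvd := by rw [Rat.den_intCast]; simp
  lt := by push_cast; linarith
  le := by push_cast; linarith
  eq := by rw [Rat.den_intCast, Rat.den_intCast]; push_cast; ring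

/-! ### The two Möbius contractions of a pair -/

/-- The Möbius map `z ↦ α + 1 / (r_α² (α + 3 - z))`, contracting towards `α + x_α`. -/
noncomputable def leftMap (α : ℚ) (z : ℝ) : ℝ := α + 1 / (α.den : ℝ) ^ 2 / (α + 3 - z)

/-- The Möbius map `z ↦ β - 1 / (r_β² (z + 3 - β))`, contracting towards `β - x_β`. -/
noncomputable def rightMap (β : ℚ) (z : ℝ) : ℝ := β - 1 / (β.den : ℝ) ^ 2 / (z + 3 - β)

theorem inv_sq_pos (α : ℚ) : 0 < 1 / (α.den : ℝ) ^ 2 := by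
  have : (0 : ℝ) < α.den := by exact_mod_cast α.den_pos
  positivity

theorem leftMap_lt {α : ℚ} {z w : ℝ} (hw : w < α + 3) (h : z < w) :
    leftMap α z < leftMap α w := by
  unfold leftMap
  have := inv_sq_pos α
  have h1 : 0 < α + 3 - w := by linarith
  have h2 : α + 3 - w < α + 3 - z := by linarith
  gcongr

theorem rightMap_lt {β : ℚ} {z w : ℝ} (hz : β - 3 < z) (h : z < w) :
    rightMap β z < rightMap β w := by
  unfold rightMap
  have := inv_sq_pos β
  have h1 : 0 < z + 3 - β := by linarith
  gcongr

theorem leftMap_lt_iff {α : ℚ} {z w : ℝ} (hz : z < α + 3) (hw : w < α + 3) :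
    leftMap α z < leftMap α w ↔ z < w :=
  ⟨fun h => by
    by_contra! hc
    rcases hc.eq_or_lt with e | e
    · exact (e ▸ h).false
    · exact (h.trans (leftMap_lt hz e)).false, leftMap_lt hw⟩

theorem rightMap_lt_iff {β : ℚ} {z w : ℝ} (hz : β - 3 < z) (hw : β - 3 < w) :
    rightMap β z < rightMap β w ↔ z < w :=
  ⟨fun h => by
    by_contra! hc
    rcases hc.eq_or_lt with e | e
    · exact (e ▸ h).false
    · exact (h.trans (rightMap_lt hw e)).false, rightMap_lt hz⟩

theorem leftMap_le_iff {α : ℚ} {z w : ℝ} (hz : z < α + 3) (hw : w < α + 3) :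
    leftMap α z ≤ leftMap α w ↔ z ≤ w := by
  simpa using (leftMap_lt_iff hw hz).not

theorem rightMap_le_iff {β : ℚ} {z w : ℝ} (hz : β - 3 < z) (hw : β - 3 < w) :
    rightMap β z ≤ rightMap β w ↔ z ≤ w := by
  simpa using (rightMap_lt_iff hw hz).not

theorem lt_leftMap {α : ℚ} {z : ℝ} (hz : z < α + 3) : α < leftMap α z := by
  have := inv_sq_pos α
  have h1 : 0 < α + 3 - z := by linarith
  unfold leftMap
  linarith [div_pos this h1]

theorem rightMap_lt_self {β : ℚ} {z : ℝ} (hz : β - 3 < z) : rightMap β z < β := by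
  have := inv_sq_pos β
  have h1 : 0 < z + 3 - β := by linarith
  unfold rightMap
  linarith [div_pos this h1]

theorem exists_leftMap_eq {α : ℚ} {z : ℝ} (hz : α < z) : ∃ w < (α + 3 : ℝ), leftMap α w = z := by
  have := inv_sq_pos α
  have h1 : 0 < z - α := by linarith
  refine ⟨α + 3 - 1 / (α.den : ℝ) ^ 2 / (z - α), by linarith [div_pos this h1], ?_⟩
  unfold leftMap
  rw [sub_sub_cancel, div_div_cancel₀ this.ne']
  ring

theorem exists_rightMap_eq {β : ℚ} {z : ℝ} (hz : z < β) :
    ∃ w > (β - 3 : ℝ), rightMap β w = z := by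
  have := inv_sq_pos β
  have h1 : 0 < β - z := by linarith
  refine ⟨β - 3 + 1 / (β.den : ℝ) ^ 2 / (β - z), by linarith [div_pos this h1], ?_⟩
  unfold rightMap
  rw [show (β : ℝ) - 3 + 1 / (β.den : ℝ) ^ 2 / (β - z) + 3 - β = 1 / (β.den : ℝ) ^ 2 / (β - z) by
    ring, div_div_cancel₀ this.ne']
  ring

theorem Adj.le_real {α β : ℚ} (h : Adj α β) : (β : ℝ) ≤ α + 1 := by exact_mod_cast h.le

theorem Adj.lt_dot_real {α β : ℚ} (h : Adj α β) : (α : ℝ) < dot α β := by exact_mod_cast h.lt_dot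

theorem Adj.dot_lt_real {α β : ℚ} (h : Adj α β) : (dot α β : ℝ) < β := by exact_mod_cast h.dot_lt

theorem Adj.leftMap_right {α β : ℚ} (h : Adj α β) : leftMap α β = dot α β := by
  have : (dot α β : ℝ) = ((α + 1 / ((α.den : ℚ) ^ 2 * (3 - (β - α))) : ℚ) : ℝ) := by
    exact_mod_cast h.dot_eq_left
  rw [this, leftMap]
  push_cast
  rw [div_div]
  congr 3
  ring

theorem Adj.rightMap_left {α β : ℚ} (h : Adj α β) : rightMap β α = dot α β := by
  have : (dot α β : ℝ) = ((β - 1 / ((β.den : ℚ) ^ 2 * (3 - (β - α))) : ℚ) : ℝ) := by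
    exact_mod_cast h.dot_eq_right
  rw [this, rightMap]
  push_cast
  rw [div_div]
  congr 3
  ring

theorem Adj.inv_den_sq_real {α β : ℚ} (h : Adj α β) : 1 / ((dot α β).den : ℝ) ^ 2 =
    1 / (α.den : ℝ) ^ 2 * (1 / (β.den : ℝ) ^ 2) / (3 - (β - α)) ^ 2 := by
  have := congrArg (Rat.cast : ℚ → ℝ) h.inv_den_sq
  push_cast at this
  exact this

/-- With its mirror image below, this is the self-similarity behind the proof: passing to a child
pair replaces one map by a composite of the two. -/
theorem Adj.leftMap_rightMap {α β : ℚ} (h : Adj α β) {z : ℝ} (hz : α ≤ z) :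
    leftMap α (rightMap β z) = rightMap (dot α β) z := by
  have hle := h.le_real
  have e1 := h.rightMap_left
  have e2 := h.leftMap_right
  have hx := inv_sq_pos α
  have hy := inv_sq_pos β
  unfold leftMap at e2 ⊢
  unfold rightMap at e1 ⊢
  rw [h.inv_den_sq_real]
  generalize 1 / (α.den : ℝ) ^ 2 = x at *
  generalize 1 / (β.den : ℝ) ^ 2 = y at *
  generalize hu : (3 - (β - α) : ℝ) = u at *
  have hu0 : 0 < u := by linarith
  have hv : 0 < z + 3 - β := by linarith
  have e1' : (dot α β : ℝ) = β - y / u := by rw [← e1, ← hu]; ring_nf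
  have e2' : (dot α β : ℝ) = α + x / u := by rw [← e2, ← hu]; ring_nf
  have hN : 0 < u * (z + 3 - β) + y := by positivity
  have d1 : α + 3 - (β - y / (z + 3 - β)) = (u * (z + 3 - β) + y) / (z + 3 - β) := by
    rw [← hu]; field_simp; ring
  have d2 : z + 3 - dot α β = (u * (z + 3 - β) + y) / u := by
    rw [e1']; field_simp; ring
  rw [d1, d2, e2']
  field_simp
  ring

theorem Adj.rightMap_leftMap {α β : ℚ} (h : Adj α β) {z : ℝ} (hz : z ≤ β) :
    rightMap β (leftMap α z) = leftMap (dot α β) z := by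
  have hle := h.le_real
  have e1 := h.rightMap_left
  have e2 := h.leftMap_right
  have hx := inv_sq_pos α
  have hy := inv_sq_pos β
  unfold leftMap at e2 ⊢
  unfold rightMap at e1 ⊢
  rw [h.inv_den_sq_real]
  generalize 1 / (α.den : ℝ) ^ 2 = x at *
  generalize 1 / (β.den : ℝ) ^ 2 = y at *
  generalize hu : (3 - (β - α) : ℝ) = u at *
  have hu0 : 0 < u := by linarith
  have hv : 0 < α + 3 - z := by linarith
  have e1' : (dot α β : ℝ) = β - y / u := by rw [← e1, ← hu]; ring_nf
  have e2' : (dot α β : ℝ) = α + x / u := by rw [← e2, ← hu]; ring_nf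
  have hN : 0 < u * (α + 3 - z) + x := by positivity
  have d1 : α + x / (α + 3 - z) + 3 - β = (u * (α + 3 - z) + x) / (α + 3 - z) := by
    rw [← hu]; field_simp; ring
  have d2 : dot α β + 3 - z = (u * (α + 3 - z) + x) / u := by
    rw [e2']; field_simp; ring
  rw [d1, d2, e1']
  field_simp
  ring

/-! ### Cores and their images -/

/-- The closed subinterval `[α + x_α, β - x_β]` of `(α, β)`, in terms of the two contractions. -/
def core (α β : ℚ) : Set ℝ := {z | α < z ∧ z < β ∧ leftMap α z ≤ z ∧ z ≤ rightMap β z}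

theorem Adj.leftMap_mem {α β : ℚ} (h : Adj α β) {z : ℝ} (hz : z ∈ core α β) :
    leftMap α z ∈ core α β ∧ leftMap α z < dot α β := by
  obtain ⟨h1, h2, h3, h4⟩ := hz
  have hle := h.le_real
  have hl := lt_leftMap (α := α) (z := z) (by linarith)
  have hd : leftMap α z < dot α β := h.leftMap_right ▸ leftMap_lt (by linarith) h2
  have hr : dot α β < rightMap β (leftMap α z) :=
    h.rightMap_left ▸ rightMap_lt (by linarith) hl
  exact ⟨⟨hl, by linarith, (leftMap_le_iff (by linarith) (by linarith)).2 h3, by linarith⟩, hd⟩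

theorem Adj.rightMap_mem {α β : ℚ} (h : Adj α β) {z : ℝ} (hz : z ∈ core α β) :
    rightMap β z ∈ core α β ∧ dot α β < rightMap β z := by
  obtain ⟨h1, h2, h3, h4⟩ := hz
  have hle := h.le_real
  have hl := rightMap_lt_self (β := β) (z := z) (by linarith)
  have hd : dot α β < rightMap β z := h.rightMap_left ▸ rightMap_lt (by linarith) h1
  have hr : leftMap α (rightMap β z) < dot α β :=
    h.leftMap_right ▸ leftMap_lt (by linarith) hl
  exact ⟨⟨by linarith, hl, by linarith, (rightMap_le_iff (by linarith) (by linarith)).2 h4⟩, hd⟩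

/-- Write z = L_α(w). The defining inequalities of the smaller core are L_α(z) ≤ L_α(w) ≤
L_α(R_β(z)); cancelling L_α gives z ≤ w ≤ R_β(z) ≤ R_β(w). -/
theorem Adj.core_left {α β : ℚ} (h : Adj α β) {z : ℝ} (hz : z ∈ core α (dot α β)) :
    z ∈ core α β ∧ ∃ w ∈ core α β, z = leftMap α w := by
  obtain ⟨h1, h2, h3, h4⟩ := hz
  have hle := h.le_real
  have hlt := h.lt_dot_real
  have hlt' := h.dot_lt_real
  obtain ⟨w, hw, rfl⟩ := exists_leftMap_eq h1
  set z := leftMap α w with hzdef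
  have hwβ : w < β := by
    rw [← leftMap_lt_iff hw (by linarith), h.leftMap_right]; exact h2
  have hzw : z ≤ w := by rwa [← leftMap_le_iff (by linarith) hw]
  have hzr : dot α β < rightMap β z := h.rightMap_left ▸ rightMap_lt (by linarith) h1
  have hwz : w ≤ rightMap β z := by
    rw [← leftMap_le_iff hw
      ((rightMap_lt_self (β := β) (z := z) (by linarith)).trans (by linarith)),
      h.leftMap_rightMap h1.le]
    exact h4
  refine ⟨⟨h1, by linarith, h3, by linarith⟩, w, ⟨by linarith, hwβ, hzw, hwz.trans ?_⟩, rfl⟩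
  exact (rightMap_le_iff (by linarith) (by linarith)).2 hzw

theorem Adj.core_right {α β : ℚ} (h : Adj α β) {z : ℝ} (hz : z ∈ core (dot α β) β) :
    z ∈ core α β ∧ ∃ w ∈ core α β, z = rightMap β w := by
  obtain ⟨h1, h2, h3, h4⟩ := hz
  have hle := h.le_real
  have hlt := h.lt_dot_real
  have hlt' := h.dot_lt_real
  obtain ⟨w, hw, rfl⟩ := exists_rightMap_eq h2
  set z := rightMap β w with hzdef
  have hwα : α < w := by
    rw [← rightMap_lt_iff (by linarith) hw, h.rightMap_left]; exact h1
  have hzw : w ≤ z := by rwa [← rightMap_le_iff hw (by linarith)]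
  have hzr : leftMap α z < dot α β := h.leftMap_right ▸ leftMap_lt (by linarith) h2
  have hwz : leftMap α z ≤ w := by
    rw [← rightMap_le_iff
      (lt_trans (by linarith) (lt_leftMap (α := α) (z := z) (by linarith))) hw,
      h.rightMap_leftMap h2.le]
    exact h3
  refine ⟨⟨by linarith, h2, by linarith, h4⟩, w, ⟨hwα, by linarith, le_trans ?_ hwz, hzw⟩, rfl⟩
  exact (leftMap_le_iff (by linarith) (by linarith)).2 hzw

/-! ### Chains and itineraries -/

/-- A nested sequence of adjacent pairs, each obtained from the previous one by replacing one of
the two entries by `α.β`. -/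
structure IsChain (α β : ℕ → ℚ) : Prop where
  adj : ∀ n, Adj (α n) (β n)
  step : ∀ n, (α (n + 1) = α n ∧ β (n + 1) = dot (α n) (β n)) ∨
    (α (n + 1) = dot (α n) (β n) ∧ β (n + 1) = β n)

/-- `z` is the image of `w` under one of the two contractions of the pair `(α, β)`. -/
def Branch (α β : ℚ) (w z : ℝ) : Prop := z = leftMap α w ∨ z = rightMap β w

/-- The points with an itinerary of length `k` under the two contractions of `(α, β)`. -/
def Coded (α β : ℚ) : ℕ → ℝ → Prop
  | 0, z => z ∈ core α β
  | k + 1, z => z ∈ core α β ∧ ∃ w, Coded α β k w ∧ Branch α β w z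

theorem Coded.mem_core {α β : ℚ} {k : ℕ} {z : ℝ} (h : Coded α β k z) : z ∈ core α β := by
  cases k with
  | zero => exact h
  | succ k => exact h.1

theorem Coded.pred {α β : ℚ} {k : ℕ} {z : ℝ} (h : Coded α β (k + 1) z) :
    Coded α β k z := by
  induction k generalizing z with
  | zero => exact h.1
  | succ k ih =>
    obtain ⟨h1, w, hw, hb⟩ := h
    exact ⟨h1, w, ih hw, hb⟩

theorem Adj.branch_mem_core {α β : ℚ} (h : Adj α β) {w z : ℝ} (hw : w ∈ core α β)
    (hb : Branch α β w z) : z ∈ core α β := by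
  rcases hb with rfl | rfl
  · exact (h.leftMap_mem hw).1
  · exact (h.rightMap_mem hw).1

theorem Adj.branch_inj {α β : ℚ} (h : Adj α β) {v w z : ℝ} (hv : v ∈ core α β)
    (hw : w ∈ core α β) (hbv : Branch α β v z) (hbw : Branch α β w z) : v = w := by
  have hle := h.le_real
  have ⟨v1, v2, _⟩ := hv
  have ⟨w1, w2, _⟩ := hw
  rcases hbv with rfl | rfl <;> rcases hbw with e | e
  · exact le_antisymm ((leftMap_le_iff (by linarith) (by linarith)).1 e.le)
      ((leftMap_le_iff (by linarith) (by linarith)).1 e.ge)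
  · have := (h.leftMap_mem hv).2
    have := (h.rightMap_mem hw).2
    linarith
  · have := (h.rightMap_mem hv).2
    have := (h.leftMap_mem hw).2
    linarith
  · exact le_antisymm ((rightMap_le_iff (by linarith) (by linarith)).1 e.le)
      ((rightMap_le_iff (by linarith) (by linarith)).1 e.ge)

/-- The two images lie on opposite sides of α.β and each map is injective, so the preimage in the
core is unique; the itineraries of all lengths share the same first preimage. -/
theorem Adj.exists_branch {α β : ℚ} (h : Adj α β) {z : ℝ} (hz : ∀ k, Coded α β k z) :
    ∃ w, (∀ k, Coded α β k w) ∧ Branch α β w z := by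
  obtain ⟨-, w, hw, hb⟩ := hz 1
  refine ⟨w, fun k => ?_, hb⟩
  obtain ⟨-, v, hv, hb'⟩ := hz (k + 1)
  rwa [h.branch_inj hw.mem_core hv.mem_core hb hb']

namespace IsChain

variable {α β : ℕ → ℚ}

theorem core_succ (h : IsChain α β) {n : ℕ} {z : ℝ} (hz : z ∈ core (α (n + 1)) (β (n + 1))) :
    z ∈ core (α n) (β n) ∧ ∃ w ∈ core (α n) (β n), Branch (α n) (β n) w z := by
  rcases h.step n with ⟨e1, e2⟩ | ⟨e1, e2⟩ <;> rw [e1, e2] at hz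
  · obtain ⟨h1, w, hw, e⟩ := (h.adj n).core_left hz
    exact ⟨h1, w, hw, .inl e⟩
  · obtain ⟨h1, w, hw, e⟩ := (h.adj n).core_right hz
    exact ⟨h1, w, hw, .inr e⟩

/-- A contraction of a pair in the chain is a contraction of the previous pair or a composition of
two such. -/
theorem branch_succ (h : IsChain α β) {n : ℕ} {w z : ℝ} (hw : w ∈ core (α n) (β n))
    (hb : Branch (α (n + 1)) (β (n + 1)) w z) :
    Branch (α n) (β n) w z ∨ ∃ v, Branch (α n) (β n) w v ∧ Branch (α n) (β n) v z := by
  have ha := h.adj n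
  rcases h.step n with ⟨e1, e2⟩ | ⟨e1, e2⟩ <;> unfold Branch at hb <;> rw [e1, e2] at hb <;>
    rcases hb with e | e
  · exact .inl (.inl e)
  · exact .inr ⟨_, .inr rfl, .inl (by rw [ha.leftMap_rightMap hw.1.le]; exact e)⟩
  · exact .inr ⟨_, .inl rfl, .inr (by rw [ha.rightMap_leftMap hw.2.1.le]; exact e)⟩
  · exact .inl (.inr e)

/-- Moving up one level lengthens the itinerary, so membership in the cores at all deeper levels
yields itineraries of every length. -/
theorem coded_succ (h : IsChain α β) {n k : ℕ} {z : ℝ}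
    (hz : Coded (α (n + 1)) (β (n + 1)) k z) : Coded (α n) (β n) (k + 1) z := by
  induction k generalizing z with
  | zero =>
    obtain ⟨h1, w, hw, hb⟩ := h.core_succ hz
    exact ⟨h1, w, hw, hb⟩
  | succ k ih =>
    obtain ⟨h1, w, hw, hb⟩ := hz
    have h2 := (h.core_succ h1).1
    have hw' := ih hw
    rcases h.branch_succ hw'.mem_core hb with hb | ⟨v, hv, hb⟩
    · exact ⟨h2, w, hw', hb⟩
    · exact Coded.pred ⟨h2, v, ⟨(h.adj n).branch_mem_core hw'.mem_core hv, w, hw', hv⟩, hb⟩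

theorem coded_of_forall_mem_core (h : IsChain α β) {z : ℝ} (hz : ∀ n, z ∈ core (α n) (β n))
    (n k : ℕ) : Coded (α n) (β n) k z := by
  induction k generalizing n with
  | zero => exact hz n
  | succ k ih => exact h.coded_succ (ih (n + 1))

theorem forall_coded_of_succ (h : IsChain α β) {n : ℕ} {z : ℝ}
    (hz : ∀ k, Coded (α (n + 1)) (β (n + 1)) k z) (k : ℕ) : Coded (α n) (β n) k z :=
  (h.coded_succ (hz k)).pred

theorem mem_of_branch (h : IsChain α β) {O : Set ℝ}
    (hO : ∀ z ∈ O, ∀ w ∈ core (α 0) (β 0), Branch (α 0) (β 0) w z → w ∈ O) (n : ℕ) :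
    ∀ z ∈ O, ∀ w, (∀ k, Coded (α n) (β n) k w) → Branch (α n) (β n) w z → w ∈ O := by
  induction n with
  | zero => exact fun z hz w hw hb => hO z hz w (hw 0) hb
  | succ n ih =>
    intro z hz w hw hb
    have hw' := h.forall_coded_of_succ hw
    rcases h.branch_succ (hw' 0) hb with hb | ⟨v, hv, hb⟩
    · exact ih z hz w hw' hb
    · refine ih v (ih z hz v (fun k => ?_) hb) w hw' hv
      exact Coded.pred ⟨(h.adj n).branch_mem_core (hw' 0) hv, w, hw' k, hv⟩

/-- A point in all cores of a chain whose orbit under the inverse branches is finite is a fixed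
point of one of the contractions. -/
theorem exists_fixed (h : IsChain α β) {O : Set ℝ} (hfin : O.Finite)
    (hO : ∀ z ∈ O, ∀ w ∈ core (α 0) (β 0), Branch (α 0) (β 0) w z → w ∈ O) {ξ : ℝ}
    (hξ : ξ ∈ O) (hcore : ∀ n, ξ ∈ core (α n) (β n)) :
    ∃ n, leftMap (α n) ξ = ξ ∨ rightMap (β n) ξ = ξ := by
  set S : ℕ → Set ℝ := fun n => {z ∈ O | ∀ k, Coded (α n) (β n) k z} with hS
  have hSfin : ∀ n, (S n).Finite := fun n => hfin.subset fun z hz => hz.1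
  have hanti : ∀ n, S (n + 1) ⊆ S n := fun n z hz => ⟨hz.1, h.forall_coded_of_succ hz.2⟩
  -- A decreasing sequence of finite sets cannot drop strictly at every step.
  obtain ⟨n, hn⟩ : ∃ n, S (n + 1) = S n := by
    by_contra! hne
    have hlt : ∀ n, (S (n + 1)).ncard < (S n).ncard := fun n =>
      Set.ncard_lt_ncard ((hanti n).ssubset_of_ne (hne n)) (hSfin n)
    have hbd : ∀ n, (S n).ncard + n ≤ (S 0).ncard := by
      intro n
      induction n with
      | zero => simp
      | succ n ih => have := hlt n; omega
    have := hbd ((S 0).ncard + 1)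
    omega
  have hξS : ξ ∈ S n := ⟨hξ, h.coded_of_forall_mem_core hcore n⟩
  have ha := h.adj n
  have hpre : ∀ z ∈ S n, ∃ w ∈ S n, Branch (α n) (β n) w z := by
    intro z hz
    obtain ⟨w, hw, hb⟩ := ha.exists_branch hz.2
    exact ⟨w, ⟨h.mem_of_branch hO n z hz.1 w hw hb, hw⟩, hb⟩
  refine ⟨n, ?_⟩
  by_contra! hne
  rcases h.step n with ⟨e1, e2⟩ | ⟨e1, e2⟩
  · have hT : {z ∈ S n | leftMap (α n) z ≠ z}.Finite := (hSfin n).subset fun z hz => hz.1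
    -- Since S (n + 1) = S n, all of S n lies below α.β, so preimages in S n are taken along L_α and
    -- move points upwards. A largest non-fixed point has no possible preimage: a fixed one, or
    -- itself, would make it fixed.
    obtain ⟨m, hm⟩ := hT.exists_maximal ⟨ξ, hξS, hne.1⟩
    obtain ⟨w, hw, hb⟩ := hpre m hm.1.1
    have hmc := ((hn ▸ hm.1.1 : m ∈ S (n + 1)).2 0).mem_core
    rw [e1, e2] at hmc
    rcases hb with hb | hb
    · have hle : m ≤ w := hb ▸ (hw.2 0).mem_core.2.2.1
      by_cases hfix : leftMap (α n) w = w
      · exact hm.1.2 (by rw [hb, hfix, hfix])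
      · have := hm.2 ⟨hw, hfix⟩ hle
        have hwm : w = m := le_antisymm this hle
        exact hfix (by rw [← hb, hwm])
    · have := (ha.rightMap_mem (hw.2 0).mem_core).2
      have := hmc.2.1
      linarith
  · have hT : {z ∈ S n | rightMap (β n) z ≠ z}.Finite := (hSfin n).subset fun z hz => hz.1
    obtain ⟨m, hm⟩ := hT.exists_minimal ⟨ξ, hξS, hne.2⟩
    obtain ⟨w, hw, hb⟩ := hpre m hm.1.1
    have hmc := ((hn ▸ hm.1.1 : m ∈ S (n + 1)).2 0).mem_core
    rw [e1, e2] at hmc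
    rcases hb with hb | hb
    · have := (ha.leftMap_mem (hw.2 0).mem_core).2
      have := hmc.1
      linarith
    · have hle : w ≤ m := hb ▸ (hw.2 0).mem_core.2.2.2
      by_cases hfix : rightMap (β n) w = w
      · exact hm.1.2 (by rw [hb, hfix, hfix])
      · have := hm.2 ⟨hw, hfix⟩ hle
        have hwm : w = m := le_antisymm hle this
        exact hfix (by rw [← hb, hwm])

end IsChain

/-! ### Finiteness of inverse orbits of quadratic numbers -/

theorem finite_setOf_quadratic_root {a b c : ℝ} (h : b ^ 2 - 4 * a * c ≠ 0) :
    {w : ℝ | a * w ^ 2 + b * w + c = 0}.Finite := by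
  set p : Polynomial ℝ := .C a * .X ^ 2 + .C b * .X + .C c with hp
  have hp0 : p ≠ 0 := by
    intro h0
    apply h
    have ha : a = 0 := by
      simpa [hp, Polynomial.coeff_X, Polynomial.coeff_C] using congrArg (·.coeff 2) h0
    have hb : b = 0 := by
      simpa [hp, Polynomial.coeff_X, Polynomial.coeff_C] using congrArg (·.coeff 1) h0
    simp [ha, hb]
  refine (Polynomial.finite_setOfPred_isRoot hp0).subset fun w hw => ?_
  simpa [hp, Polynomial.IsRoot] using hw

/-- Numbers in `[m, m + 1]` whose translate by `-m` is a root of an integral quadratic form of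
discriminant `d` with leading coefficient at most `M` in absolute value. -/
def quadraticPoints (m M d : ℤ) : Set ℝ :=
  {z | m ≤ z ∧ z ≤ m + 1 ∧ ∃ A B C : ℤ, |A| ≤ M ∧ B ^ 2 - 4 * A * C = d ∧
    A * (z - m) ^ 2 + B * (z - m) + C = 0}

/-- At a root the derivative of the form squares to its discriminant. -/
theorem abs_deriv_le {A B C M d : ℤ} {w : ℝ} (hM : 0 ≤ M) (hd : d ≤ M ^ 2)
    (h : B ^ 2 - 4 * A * C = d) (hw : A * w ^ 2 + B * w + C = 0) : |2 * A * w + B| ≤ M := by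
  have hM' : (0 : ℝ) ≤ M := by exact_mod_cast hM
  have hd' : (d : ℝ) ≤ M ^ 2 := by exact_mod_cast hd
  have h' : (B ^ 2 - 4 * A * C : ℝ) = d := by exact_mod_cast h
  apply abs_le_of_sq_le_sq _ hM'
  linear_combination hd' + h' + 4 * A * hw

theorem finite_quadraticPoints {m M d : ℤ} (hM : 0 ≤ M) (hd0 : d ≠ 0) (hd : d ≤ M ^ 2) :
    (quadraticPoints m M d).Finite := by
  have hf : (⋃ t ∈ (Set.Icc (-M) M ×ˢ Set.Icc (-(3 * M)) (3 * M) ×ˢ Set.Icc (-(4 * M)) (4 * M) ∩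
      {t | t.2.1 ^ 2 - 4 * t.1 * t.2.2 = d} : Set (ℤ × ℤ × ℤ)),
      (fun z : ℝ => z - m) ⁻¹' {w : ℝ | t.1 * w ^ 2 + t.2.1 * w + t.2.2 = 0}).Finite := by
    refine Set.Finite.biUnion (Set.Finite.inter_of_left ((Set.finite_Icc _ _).prod
      ((Set.finite_Icc _ _).prod (Set.finite_Icc _ _))) _) fun t ht => ?_
    refine Set.Finite.preimage (sub_left_injective.injOn) (finite_setOf_quadratic_root ?_)
    have hdt := ht.2.trans_ne hd0
    exact_mod_cast hdt
  refine hf.subset fun z hz => ?_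
  obtain ⟨h1, h2, A, B, C, hA, hdisc, hroot⟩ := hz
  have hB := abs_deriv_le hM hd hdisc hroot
  set w := z - m with hw
  have hw0 : 0 ≤ w := by linarith
  have hw1 : w ≤ 1 := by linarith
  have hA' : |(A : ℝ)| ≤ M := by exact_mod_cast hA
  have hAw : |A * w| ≤ M := by
    rw [abs_mul, abs_of_nonneg hw0]
    exact (mul_le_of_le_one_right (abs_nonneg _) hw1).trans hA'
  have hAw2 : |A * w ^ 2| ≤ M := by
    rw [abs_mul, abs_of_nonneg (pow_nonneg hw0 2)]
    exact (mul_le_of_le_one_right (abs_nonneg _) (pow_le_one₀ hw0 hw1)).trans hA'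
  rw [abs_le] at hB hAw hAw2
  have hB3 : |(B : ℝ)| ≤ 3 * M := by rw [abs_le]; constructor <;> linarith [hAw.1, hAw.2]
  have hBw : |B * w| ≤ 3 * M := by
    rw [abs_mul, abs_of_nonneg hw0]
    exact (mul_le_of_le_one_right (abs_nonneg _) hw1).trans hB3
  rw [abs_le] at hBw
  have hC4 : |(C : ℝ)| ≤ 4 * M := by rw [abs_le]; constructor <;> linarith
  have hB3' : |B| ≤ 3 * M := by exact_mod_cast hB3
  have hC4' : |C| ≤ 4 * M := by exact_mod_cast hC4
  simp only [Set.mem_iUnion]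
  exact ⟨(A, B, C), ⟨⟨abs_le.1 hA, abs_le.1 hB3', abs_le.1 hC4'⟩, hdisc⟩, hroot⟩

/-- The substitution preserves the discriminant. The new leading coefficient is a factor v or 1 - v,
at most 1/2 on the relevant image, times a quantity of size at most 2M, so the bound M survives. -/
theorem quadraticPoints_closed {m M d : ℤ} (hM : 0 ≤ M) (hd : d ≤ M ^ 2) :
    ∀ z ∈ quadraticPoints m M d, ∀ w ∈ core m (m + 1 : ℤ), Branch m (m + 1 : ℤ) w z →
      w ∈ quadraticPoints m M d := by
  rintro z ⟨h1, h2, A, B, C, hA, hdisc, hroot⟩ w ⟨hw1, hw2, -⟩ hb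
  have hB := abs_deriv_le hM hd hdisc hroot
  have hA' : |(A : ℝ)| ≤ M := by exact_mod_cast hA
  have hM' : (0 : ℝ) ≤ M := by exact_mod_cast hM
  push_cast at hw1 hw2
  unfold Branch leftMap rightMap at hb
  rw [Rat.den_intCast, Rat.den_intCast] at hb
  push_cast at hb
  refine ⟨hw1.le, hw2.le, ?_⟩
  obtain ⟨u, hu⟩ : ∃ u, w = u + m := ⟨w - m, by ring⟩
  obtain ⟨v, hv⟩ : ∃ v, z = v + m := ⟨z - m, by ring⟩
  subst hu hv
  simp only [add_sub_cancel_right] at *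
  have hu0 : 0 < u := by linarith
  have hu1 : u < 1 := by linarith
  have hv0 : 0 ≤ v := by linarith
  have hv1 : v ≤ 1 := by linarith
  rw [abs_le] at hA' hB
  rcases hb with hb | hb
  · have h3 : 0 < 3 - u := by linarith
    have hv' : v = 1 / (3 - u) := by
      rw [show (3 : ℝ) - u = m + 3 - (u + m) by ring]; linarith [hb]
    have hvu : v * (3 - u) = 1 := by rw [hv']; field_simp
    have hvh : v ≤ 1 / 2 := by nlinarith
    refine ⟨C, -B - 6 * C, A + 3 * B + 9 * C, ?_, by rw [← hdisc]; ring, ?_⟩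
    · have hC : (C : ℝ) = -(v * ((2 * A * v + B) - v * A)) := by linear_combination hroot
      have : |(C : ℝ)| ≤ M := by
        rw [hC, abs_neg, abs_mul, abs_of_nonneg hv0]
        have h4 : |2 * A * v + B - v * A| ≤ 2 * M := by
          rw [abs_le]; constructor <;> nlinarith
        nlinarith [abs_nonneg (2 * A * v + B - v * A)]
      exact_mod_cast this
    · push_cast
      linear_combination (3 - u) ^ 2 * hroot - (A * (v * (3 - u) + 1) + B * (3 - u)) * hvu
  · have h3 : 0 < u + 2 := by linarith
    have hv' : v = 1 - 1 / (u + 2) := by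
      rw [show u + 2 = u + m + 3 - (m + 1) by ring]; linarith [hb]
    have hvu : v * (u + 2) = u + 1 := by rw [hv']; field_simp; ring
    have hvh : 1 - v ≤ 1 / 2 := by nlinarith
    refine ⟨A + B + C, 2 * A + 3 * B + 4 * C, A + 2 * B + 4 * C, ?_, by rw [← hdisc]; ring, ?_⟩
    · have hC : (A + B + C : ℝ) = (1 - v) * ((2 * A * v + B) + (1 - v) * A) := by
        linear_combination hroot
      have : |(A + B + C : ℝ)| ≤ M := by
        have hv1' : 0 ≤ 1 - v := by linarith
        rw [hC, abs_mul, abs_of_nonneg hv1']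
        have h4 : |2 * A * v + B + (1 - v) * A| ≤ 2 * M := by
          rw [abs_le]; constructor <;> nlinarith
        nlinarith [abs_nonneg (2 * A * v + B + (1 - v) * A)]
      exact_mod_cast this
    · push_cast
      linear_combination (u + 2) ^ 2 * hroot -
        (A * (v * (u + 2) + (u + 1)) + B * (u + 2)) * hvu

/-! ### Irrationality of fixed points and the exclusion of D > 5 -/

/-- The numbers `x_α` and `3 - x_α`, the roots of `q ^ 2 - 3 q + 1 / r_α ^ 2`, are irrational. -/
theorem quadratic_ne_zero (α q : ℚ) : q ^ 2 - 3 * q + 1 / (α.den : ℚ) ^ 2 ≠ 0 := by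
  intro h
  have h0 : (α.den : ℚ) ≠ 0 := by exact_mod_cast α.den_nz
  have hsq : IsSquare ((9 * (α.den : ℤ) ^ 2 - 4 : ℤ) : ℚ) := by
    refine ⟨(2 * q - 3) * α.den, ?_⟩
    field_simp at h
    push_cast
    linear_combination -4 * h
  rw [Rat.isSquare_intCast_iff] at hsq
  obtain ⟨k, hk⟩ := hsq
  have hr : (1 : ℤ) ≤ α.den := by exact_mod_cast α.den_pos
  have hk' : |k| ^ 2 = 9 * (α.den : ℤ) ^ 2 - 4 := by rw [sq_abs, hk]; ring
  -- 9r² - 4 lies strictly between (3r - 1)² and (3r)².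
  have h1 : |k| < 3 * α.den := lt_of_pow_lt_pow_left₀ 2 (by positivity) (by rw [hk']; nlinarith)
  have h2 : 3 * α.den - 1 < |k| :=
    lt_of_pow_lt_pow_left₀ 2 (abs_nonneg k) (by rw [hk']; nlinarith)
  omega

theorem irrational_of_quadratic {α : ℚ} {y : ℝ} (h : y ^ 2 - 3 * y + 1 / (α.den : ℝ) ^ 2 = 0) :
    Irrational y := by
  rintro ⟨q, rfl⟩
  refine quadratic_ne_zero α q ((Rat.cast_eq_zero (α := ℝ)).1 ?_)
  push_cast
  exact h

/-- Expanding gives √D (e + 3/2) ∈ ℚ, so unless e = -3/2 the root would be rational. -/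
theorem eq_of_quadratic {α e D : ℚ} (hD : 0 ≤ D)
    (h : (Real.sqrt D / 2 - e) ^ 2 - 3 * (Real.sqrt D / 2 - e) + 1 / (α.den : ℝ) ^ 2 = 0) :
    e = -3 / 2 ∧ D = 9 - 4 / (α.den : ℚ) ^ 2 := by
  have hs : Real.sqrt D ^ 2 = D := Real.sq_sqrt (by exact_mod_cast hD)
  have hirr := irrational_of_quadratic h
  set s := Real.sqrt D
  have he : e = -3 / 2 := by
    by_contra hne
    have hne' : (e + 3 / 2 : ℝ) ≠ 0 := by
      intro h0
      apply hne
      have : (e : ℝ) = ((-3 / 2 : ℚ) : ℝ) := by push_cast; linarith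
      exact_mod_cast this
    apply hirr
    refine ⟨(D / 4 + e ^ 2 + 3 * e + 1 / (α.den : ℚ) ^ 2) / (e + 3 / 2) / 2 - e, ?_⟩
    push_cast
    congr 2
    rw [div_eq_iff hne']
    linear_combination h - hs / 4
  refine ⟨he, ?_⟩
  rw [he] at h
  push_cast at h
  have : (D : ℝ) = ((9 - 4 / (α.den : ℚ) ^ 2 : ℚ) : ℝ) := by
    push_cast
    linear_combination 4 * h - hs
  exact_mod_cast this

theorem leftMap_sqrt_ne {D : ℚ} (hD : 5 < D) {α : ℚ}
    (hlt : ((-3 + Real.sqrt D) / 2 : ℝ) < α + 3) :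
    leftMap α ((-3 + Real.sqrt D) / 2) ≠ (-3 + Real.sqrt D) / 2 := by
  intro h
  unfold leftMap at h
  have h3 : (α + 3 - (-3 + Real.sqrt D) / 2 : ℝ) ≠ 0 := by linarith
  have h4 : 1 / (α.den : ℝ) ^ 2 =
      ((-3 + Real.sqrt D) / 2 - α) * (α + 3 - (-3 + Real.sqrt D) / 2) := by
    rw [← div_eq_iff h3]; linarith
  obtain ⟨h5, h6⟩ := eq_of_quadratic (α := α) (e := α + 3 / 2) (D := D) (by linarith)
    (by push_cast; rw [h4]; ring)
  -- The centre is an integer, so its denominator is 1 and D = 9 - 4 = 5.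
  have h7 : α = (-3 : ℤ) := by push_cast; linarith
  rw [h7, Rat.den_intCast] at h6
  norm_num at h6
  linarith

theorem rightMap_sqrt_ne {D : ℚ} (hD : 5 < D) {β : ℚ}
    (hlt : (β - 3 : ℝ) < (-3 + Real.sqrt D) / 2) :
    rightMap β ((-3 + Real.sqrt D) / 2) ≠ (-3 + Real.sqrt D) / 2 := by
  intro h
  unfold rightMap at h
  have h3 : ((-3 + Real.sqrt D) / 2 + 3 - β : ℝ) ≠ 0 := by linarith
  have h4 : 1 / (β.den : ℝ) ^ 2 =
      (β - (-3 + Real.sqrt D) / 2) * ((-3 + Real.sqrt D) / 2 + 3 - β) := by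
    rw [← div_eq_iff h3]; linarith
  obtain ⟨h5, h6⟩ := eq_of_quadratic (α := β) (e := β - 3 / 2) (D := D) (by linarith)
    (by push_cast; rw [h4]; ring)
  have h7 : β = (0 : ℤ) := by push_cast; linarith
  rw [h7, Rat.den_intCast] at h6
  norm_num at h6
  linarith

/-! ### From avoiding the intervals to lying in every core -/

theorem radius_pos (α : ℚ) : 0 < radius α := by
  have := inv_sq_pos α
  unfold radius
  rw [sub_pos, Real.sqrt_lt' (by norm_num)]
  linarith

theorem mem_interval_self (α : ℚ) : (α : ℝ) ∈ interval α := by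
  have := radius_pos α
  exact ⟨by linarith, by linarith⟩

/-- x_α is the smaller root of y(3 - y) = 1 / r_α², and y ≤ 1 stays below the larger one. -/
theorem inv_sq_le_of_radius_le {α : ℚ} {y : ℝ} (h : radius α ≤ y) (hy : y ≤ 1) :
    1 / (α.den : ℝ) ^ 2 ≤ y * (3 - y) := by
  have h1 : 3 / 2 - y ≤ Real.sqrt (9 / 4 - 1 / (α.den : ℝ) ^ 2) := by
    unfold radius at h
    linarith
  rw [Real.le_sqrt' (by linarith)] at h1
  linarith

theorem leftMap_le_of_notMem_interval {α : ℚ} {z : ℝ} (h : z ∉ interval α) (h1 : α < z)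
    (h2 : z ≤ α + 1) : leftMap α z ≤ z := by
  have hr : radius α ≤ z - α := by
    by_contra! hc
    have := radius_pos α
    exact h ⟨by linarith, by linarith⟩
  have hq := inv_sq_le_of_radius_le hr (by linarith)
  have h3 : 0 < α + 3 - z := by linarith
  have h4 : 1 / (α.den : ℝ) ^ 2 / (α + 3 - z) ≤ z - α := by
    rw [div_le_iff₀ h3]; linarith
  unfold leftMap
  linarith

theorem le_rightMap_of_notMem_interval {β : ℚ} {z : ℝ} (h : z ∉ interval β) (h1 : z < β)
    (h2 : β ≤ z + 1) : z ≤ rightMap β z := by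
  have hr : radius β ≤ β - z := by
    by_contra! hc
    have := radius_pos β
    exact h ⟨by linarith, by linarith⟩
  have hq := inv_sq_le_of_radius_le hr (by linarith)
  have h3 : 0 < z + 3 - β := by linarith
  have h4 : 1 / (β.den : ℝ) ^ 2 / (z + 3 - β) ≤ β - z := by
    rw [div_le_iff₀ h3]; linarith
  unfold rightMap
  linarith

open scoped Classical in
/-- The nested adjacent pairs enclosing `ξ`, starting with `(⌊ξ⌋, ⌊ξ⌋ + 1)`. -/
noncomputable def enclosing (ξ : ℝ) : ℕ → ℚ × ℚ
  | 0 => ((⌊ξ⌋ : ℤ), (⌊ξ⌋ + 1 : ℤ))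
  | n + 1 =>
    if ξ < dot (enclosing ξ n).1 (enclosing ξ n).2 then
      ((enclosing ξ n).1, dot (enclosing ξ n).1 (enclosing ξ n).2)
    else (dot (enclosing ξ n).1 (enclosing ξ n).2, (enclosing ξ n).2)

theorem isChain_enclosing (ξ : ℝ) :
    IsChain (fun n => (enclosing ξ n).1) (fun n => (enclosing ξ n).2) where
  adj n := by
    induction n with
    | zero => exact adj_intCast _
    | succ n ih =>
      rw [enclosing]
      split_ifs
      · exact ih.left
      · exact ih.right
  step n := by
    rw [enclosing]
    split_ifs
    · exact .inl ⟨rfl, rfl⟩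
    · exact .inr ⟨rfl, rfl⟩

theorem enclosing_eq_eps (ξ : ℝ) (n : ℕ) :
    ∃ p : ℤ, enclosing ξ n = (eps n p, eps n (p + 1)) := by
  induction n with
  | zero => exact ⟨⌊ξ⌋, rfl⟩
  | succ n ih =>
    obtain ⟨p, hp⟩ := ih
    rw [enclosing, hp]
    split_ifs
    · exact ⟨2 * p, by rw [eps_succ_even, eps_succ_odd]⟩
    · refine ⟨2 * p + 1, ?_⟩
      rw [eps_succ_odd, show 2 * p + 1 + 1 = 2 * (p + 1) by ring, eps_succ_even]

theorem mem_core_enclosing {ξ : ℝ} (hξ : ∀ α ∈ slopes, ξ ∉ interval α) (n : ℕ) :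
    ξ ∈ core (enclosing ξ n).1 (enclosing ξ n).2 := by
  have hne : ∀ α ∈ slopes, (α : ℝ) ≠ ξ := fun α hα h => hξ α hα (h ▸ mem_interval_self α)
  have hlt : ((enclosing ξ n).1 : ℝ) < ξ ∧ ξ < (enclosing ξ n).2 := by
    induction n with
    | zero =>
      rw [enclosing]
      have h1 := hne ((⌊ξ⌋ : ℤ) : ℚ) ⟨0, ⌊ξ⌋, rfl⟩
      push_cast at h1 ⊢
      exact ⟨lt_of_le_of_ne (Int.floor_le ξ) h1, Int.lt_floor_add_one ξ⟩
    | succ n ih =>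
      obtain ⟨p, hp⟩ := enclosing_eq_eps ξ n
      have hd : dot (enclosing ξ n).1 (enclosing ξ n).2 ∈ slopes :=
        ⟨n + 1, 2 * p + 1, by rw [eps_succ_odd, hp]⟩
      rw [enclosing]
      split_ifs with hc
      · exact ⟨ih.1, hc⟩
      · exact ⟨lt_of_le_of_ne (not_lt.1 hc) (hne _ hd), ih.2⟩
  obtain ⟨p, hp⟩ := enclosing_eq_eps ξ n
  have hle := ((isChain_enclosing ξ).adj n).le_real
  exact ⟨hlt.1, hlt.2,
    leftMap_le_of_notMem_interval (hξ _ ⟨n, p, by rw [hp]⟩) hlt.1 (by linarith),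
    le_rightMap_of_notMem_interval (hξ _ ⟨n, p + 1, by rw [hp]⟩) hlt.2 (by linarith)⟩

/-! ### Conclusion for ξ -/

theorem mem_quadraticPoints_sqrt {D : ℚ} (hD : 0 < D) (m : ℤ)
    (h1 : m ≤ (-3 + Real.sqrt D) / 2) (h2 : (-3 + Real.sqrt D) / 2 ≤ m + 1) :
    ∃ M d : ℤ, 0 ≤ M ∧ d ≠ 0 ∧ d ≤ M ^ 2 ∧ (-3 + Real.sqrt D) / 2 ∈ quadraticPoints m M d := by
  have hs : Real.sqrt D ^ 2 = D := Real.sq_sqrt (by exact_mod_cast hD.le)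
  set s := Real.sqrt D
  have hn : 0 < D.num := Rat.num_pos.2 hD
  have hb : (0 : ℤ) < D.den := by exact_mod_cast D.den_pos
  have hDb : (D : ℝ) * D.den = D.num := by exact_mod_cast D.mul_den_eq_num
  have hd : 0 < 16 * D.num * D.den := by positivity
  -- The form is (2z + 3)² = D with denominators cleared and z = w + m; M is the sum of its leading
  -- coefficient and its discriminant, hence large enough for both bounds.
  refine ⟨4 * D.den + 16 * D.num * D.den, 16 * D.num * D.den, by positivity, hd.ne',
    by nlinarith, h1, h2, 4 * D.den, 4 * D.den * (3 + 2 * m), D.den * (3 + 2 * m) ^ 2 - D.num,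
    ?_, by ring, ?_⟩
  · rw [abs_of_pos (by positivity)]; linarith
  · push_cast
    linear_combination D.den * hs + hDb

theorem exists_mem_interval_sqrt {D : ℚ} (hD : 5 < D) :
    ∃ α ∈ slopes, (-3 + Real.sqrt D) / 2 ∈ interval α := by
  by_contra! hξ
  have hcore := mem_core_enclosing hξ
  have hchain := isChain_enclosing ((-3 + Real.sqrt D) / 2)
  obtain ⟨M, d, hM, hd0, hd, hmem⟩ := mem_quadraticPoints_sqrt (by linarith : 0 < D)
    ⌊(-3 + Real.sqrt D) / 2⌋ (Int.floor_le _) (Int.lt_floor_add_one _).le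
  obtain ⟨n, hn⟩ := hchain.exists_fixed (finite_quadraticPoints hM hd0 hd)
    (quadraticPoints_closed hM hd) hmem hcore
  obtain ⟨h1, h2, -⟩ := hcore n
  have hle := (hchain.adj n).le_real
  rcases hn with hn | hn
  · exact leftMap_sqrt_ne hD (by linarith) hn
  · exact rightMap_sqrt_ne hD (by linarith) hn

end ExceptionalSlope

theorem corollary3p5 (D : ℚ) (hD : 5 < D) :
    (∃ α ∈ ExceptionalSlope.slopes,
      (-3 + Real.sqrt (D : ℝ)) / 2 ∈ ExceptionalSlope.interval α) ∧
    (-3 + Real.sqrt (D : ℝ)) / 2 ∉ ExceptionalSlope.cantorSet := by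
  have h := ExceptionalSlope.exists_mem_interval_sqrt hD
  refine ⟨h, fun hc => hc ?_⟩
  obtain ⟨α, hα, hmem⟩ := h
  exact Set.mem_biUnion hα hmem
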